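/- **Theorem.** Let $\mathbb{F}_q$ be a finite field with $q$ elements and let $n,t\ge 0$ be integers. A $t$-query quantum algorithm in the matrix-vector query model over $\mathbb{F}_q$ acts on the space with orthonormal basis $|x,y,w\rangle$, where $x,y\in\mathbb{F}_q^n$ and $w$ ranges over a finite workspace set: starting from a unit vector independent of the input, it applies unitaries independent of the input, interleaved with $t$ applications of the oracle $U(M):|x,y,w\rangle\mapsto|x,y+Mx,w\rangle$ of the unknown matrix $M\in\mathbb{F}_q^{n\times n}$, and finally performs a measurement (POVM) independent of the input, with outcomes in $\mathbb{F}_q$; the outcome is its output. If such an algorithm outputs $\operatorname{tr} M$ with probability greater than $1/q$ when $M\in\mathbb{F}_q^{n\times n}$ is uniformly random, then $t\ge n/2$. In particular, if it outputs $\operatorname{tr} M$ with probability greater than $1/q$ on every $M\in\mathbb{F}_q^{n\times n}$, then $t\ge n/2$. -/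

import Mathlib

open scoped Matrix ComplexOrder

noncomputable section

/-- Labels of the computational basis: a query register `x ∈ F^n`, an answer register `y ∈ F^m`
and a workspace register `w ∈ W`. -/
abbrev MVBasis (F : Type*) (m n : ℕ) (W : Type*) : Type _ :=
  (Fin n → F) × (Fin m → F) × W

/-- The matrix-vector query `|x, y, w⟩ ↦ |x, y + M x, w⟩`, as a matrix in the computational
basis. -/
def mvOracle {F : Type*} [Field F] [DecidableEq F] {m n : ℕ} (W : Type*) [DecidableEq W]
    (M : Matrix (Fin m) (Fin n) F) : Matrix (MVBasis F m n W) (MVBasis F m n W) ℂ :=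
  Matrix.of fun i j => if i = (j.1, j.2.1 + M *ᵥ j.1, j.2.2) then 1 else 0

/-- A quantum algorithm that makes `t` matrix-vector queries to an unknown `m × n` matrix over
`F`, uses a workspace with finite basis `W`, and outputs an element of `A`: a unit starting
vector, the input-independent unitaries applied before, between and after the queries, and a
final measurement (a POVM) with outcomes in `A`. -/
structure MVQueryAlgorithm (F : Type*) [Field F] [Fintype F] [DecidableEq F] (m n : ℕ)
    (W : Type*) [Fintype W] [DecidableEq W] (t : ℕ) (A : Type*) [Fintype A] where
  init : MVBasis F m n W → ℂ
  init_norm : ∑ i, ‖init i‖ ^ 2 = 1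
  gate : Fin (t + 1) → Matrix.unitaryGroup (MVBasis F m n W) ℂ
  meas : A → Matrix (MVBasis F m n W) (MVBasis F m n W) ℂ
  meas_posSemidef : ∀ a, (meas a).PosSemidef
  meas_sum : ∑ a, meas a = 1

namespace MVQueryAlgorithm

/-- The state on input `M` after `k` queries, each followed by its gate. -/
def state {F : Type*} [Field F] [Fintype F] [DecidableEq F] {m n : ℕ}
    {W : Type*} [Fintype W] [DecidableEq W] {t : ℕ} {A : Type*} [Fintype A]
    (𝒜 : MVQueryAlgorithm F m n W t A) (M : Matrix (Fin m) (Fin n) F) (k : Fin (t + 1)) :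
    MVBasis F m n W → ℂ :=
  Fin.induction (motive := fun _ => MVBasis F m n W → ℂ)
    ((𝒜.gate 0).1 *ᵥ 𝒜.init)
    (fun i ψ => (𝒜.gate i.succ).1 *ᵥ (mvOracle W M *ᵥ ψ)) k

/-- The probability `⟨ψ| E_a |ψ⟩` that the algorithm outputs `a` on input `M`, where `ψ` is the
state after all `t` queries. -/
def outputProb {F : Type*} [Field F] [Fintype F] [DecidableEq F] {m n : ℕ}
    {W : Type*} [Fintype W] [DecidableEq W] {t : ℕ} {A : Type*} [Fintype A]
    (𝒜 : MVQueryAlgorithm F m n W t A) (M : Matrix (Fin m) (Fin n) F) (a : A) : ℝ :=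
  (star (𝒜.state M (Fin.last t)) ⬝ᵥ (𝒜.meas a *ᵥ 𝒜.state M (Fin.last t))).re

/-- The probability that the algorithm computes `f M` when `M` is a uniformly random matrix. -/
def avgSuccess {F : Type*} [Field F] [Fintype F] [DecidableEq F] {m n : ℕ}
    {W : Type*} [Fintype W] [DecidableEq W] {t : ℕ} {A : Type*} [Fintype A]
    (𝒜 : MVQueryAlgorithm F m n W t A) (f : Matrix (Fin m) (Fin n) F → A) : ℝ :=
  (∑ M : Matrix (Fin m) (Fin n) F, 𝒜.outputProb M (f M)) /
    (Fintype.card (Matrix (Fin m) (Fin n) F) : ℝ)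

end MVQueryAlgorithm

end

/-! This is the polynomial method. Each query raises the `querySpan` degree of the amplitudes by at
most one (`state_mem_querySpan`), so output probabilities have degree at most `2t`. If `U` is a
proper subspace, some `N` vanishes on `U` and has any prescribed trace
(`exists_trace_eq_of_finrank_lt`). Translating by `N` preserves every function of `M` restricted to
`U` but permutes the trace classes, so for `2t < n` each output probability has the same sum over
every trace class, and the success probability is exactly `1/q`. -/

/-- The span of the complex functions of a matrix `M` that depend only on the restriction of `M`
to some subspace of dimension at most `k`. -/
def querySpan (F : Type*) [Field F] (m n k : ℕ) :
    Submodule ℂ (Matrix (Fin m) (Fin n) F → ℂ) :=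
  Submodule.span ℂ {f | ∃ U : Submodule F (Fin n → F), Module.finrank F U ≤ k ∧
    ∀ M N : Matrix (Fin m) (Fin n) F, (∀ x ∈ U, M *ᵥ x = N *ᵥ x) → f M = f N}

section QuerySpan

variable {F : Type*} [Field F] {m n : ℕ}

theorem const_mem_querySpan (k : ℕ) (c : ℂ) :
    (fun _ => c) ∈ querySpan F m n k :=
  Submodule.subset_span ⟨⊥, by simp, fun _ _ _ => rfl⟩

theorem indicator_mem_querySpan [DecidableEq F] (x : Fin n → F) (y : Fin m → F) :
    (fun M => if M *ᵥ x = y then 1 else 0) ∈ querySpan F m n 1 := by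
  refine Submodule.subset_span ⟨Submodule.span F {x}, (finrank_span_le_card _).trans (by simp), ?_⟩
  intro M N h
  simp only [h x (Submodule.mem_span_singleton_self x)]

/-- If two factors depend on `M` only through `U` and `V`, their product depends only on `M`
restricted to `U ⊔ V`; bilinearity extends this to the spans. -/
theorem mul_mem_querySpan {j k : ℕ} {f g : Matrix (Fin m) (Fin n) F → ℂ}
    (hf : f ∈ querySpan F m n j) (hg : g ∈ querySpan F m n k) :
    (fun M => f M * g M) ∈ querySpan F m n (j + k) := by
  change f * g ∈ _
  refine Submodule.mul_le.1 ?_ f hf g hg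
  unfold querySpan
  rw [Submodule.span_mul_span]
  refine Submodule.span_mono ?_
  rintro _ ⟨f, ⟨U, hU, hf⟩, g, ⟨V, hV, hg⟩, rfl⟩
  refine ⟨U ⊔ V, (Submodule.finrank_add_le_finrank_add_finrank U V).trans (by omega), ?_⟩
  intro M N h
  simp only [Pi.mul_apply]
  rw [hf M N fun x hx => h x (Submodule.mem_sup_left hx),
    hg M N fun x hx => h x (Submodule.mem_sup_right hx)]

theorem star_mem_querySpan {k : ℕ} {f : Matrix (Fin m) (Fin n) F → ℂ}
    (hf : f ∈ querySpan F m n k) : (fun M => star (f M)) ∈ querySpan F m n k := by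
  change star f ∈ _
  refine Submodule.span_induction (p := fun f _ => star f ∈ querySpan F m n k)
    ?_ ?_ ?_ ?_ hf
  · rintro f ⟨U, hU, h⟩
    exact Submodule.subset_span ⟨U, hU, fun M N hMN => congrArg star (h M N hMN)⟩
  · simp
  · intro f g _ _ hf hg
    rw [star_add]
    exact add_mem hf hg
  · intro c f _ hf
    rw [star_smul]
    exact Submodule.smul_mem _ _ hf

theorem sum_mem_querySpan {k : ℕ} {ι : Type*} (s : Finset ι)
    {f : ι → Matrix (Fin m) (Fin n) F → ℂ} (hf : ∀ i ∈ s, f i ∈ querySpan F m n k) :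
    (fun M => ∑ i ∈ s, f i M) ∈ querySpan F m n k := by
  convert sum_mem hf using 1
  ext M
  simp

theorem mulVec_mem_querySpan {k : ℕ} {ι : Type*} [Fintype ι] (A : Matrix ι ι ℂ)
    {ψ : Matrix (Fin m) (Fin n) F → ι → ℂ} (hψ : ∀ i, (fun M => ψ M i) ∈ querySpan F m n k)
    (i : ι) : (fun M => (A *ᵥ ψ M) i) ∈ querySpan F m n k :=
  sum_mem_querySpan _ fun j _ => Submodule.smul_mem _ (A i j) (hψ j)

/-- A matrix of prescribed trace that annihilates a given proper subspace. -/
theorem exists_trace_eq_of_finrank_lt {U : Submodule F (Fin n → F)}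
    (hU : Module.finrank F U < n) (c : F) :
    ∃ N : Matrix (Fin n) (Fin n) F, N.trace = c ∧ ∀ x ∈ U, N *ᵥ x = 0 := by
  have hU' : U < ⊤ := by
    refine lt_top_iff_ne_top.2 fun h => ?_
    rw [h, finrank_top, Module.finrank_fin_fun] at hU
    exact lt_irrefl _ hU
  obtain ⟨φ, hφ, hUφ⟩ := Submodule.exists_le_ker_of_lt_top U hU'
  obtain ⟨v, hv⟩ := LinearMap.surjective hφ c
  have hdot : ∀ x, (fun i => φ (Pi.single i 1)) ⬝ᵥ x = φ x := by
    intro x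
    conv_rhs => rw [pi_eq_sum_univ' x]
    simp only [dotProduct, map_sum, map_smul, smul_eq_mul]
    refine Finset.sum_congr rfl fun i _ => ?_
    rw [mul_comm]
  -- The rank-one map `x ↦ φ x • v` has trace `φ v = c` and vanishes on `ker φ ⊇ U`.
  refine ⟨Matrix.vecMulVec v fun i => φ (Pi.single i 1), ?_, fun x hx => ?_⟩
  · rw [Matrix.trace_vecMulVec, dotProduct_comm, hdot, hv]
  · rw [Matrix.vecMulVec_mulVec, hdot, LinearMap.mem_ker.1 (hUφ hx)]
    simp

/-- A function in `querySpan F n n k` with `k < n` is uncorrelated with the trace. -/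
theorem sum_trace_eq_of_mem_querySpan [Fintype F] [DecidableEq F] {k : ℕ} (hk : k < n)
    {f : Matrix (Fin n) (Fin n) F → ℂ} (hf : f ∈ querySpan F n n k) (a b : F) :
    ∑ M, (if M.trace = a then f M else 0) = ∑ M, (if M.trace = b then f M else 0) := by
  refine Submodule.span_induction (p := fun f _ => ∑ M : Matrix (Fin n) (Fin n) F,
    (if M.trace = a then f M else 0) = ∑ M, (if M.trace = b then f M else 0)) ?_ ?_ ?_ ?_ hf
  · rintro f ⟨U, hU, h⟩
    obtain ⟨N, hN, hNU⟩ := exists_trace_eq_of_finrank_lt (hU.trans_lt hk) (b - a)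
    refine Fintype.sum_equiv (Equiv.addRight N) _ _ fun M => ?_
    have h1 : f (M + N) = f M := h _ _ fun x hx => by rw [Matrix.add_mulVec, hNU x hx, add_zero]
    have h2 : (M + N).trace = b ↔ M.trace = a := by
      rw [Matrix.trace_add, hN, ← eq_sub_iff_add_eq, sub_sub_cancel]
    simp only [Equiv.coe_addRight, h1, h2]
  · simp
  · intro f g _ _ hf hg
    simp only [Pi.add_apply, ← Finset.sum_filter, Finset.sum_add_distrib] at hf hg ⊢
    rw [hf, hg]
  · intro c f _ hf
    simp only [Pi.smul_apply, ← Finset.sum_filter, ← Finset.smul_sum] at hf ⊢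
    rw [hf]

theorem card_mul_sum_trace_of_mem_querySpan [Fintype F] [DecidableEq F] {k : ℕ} (hk : k < n)
    {f : Matrix (Fin n) (Fin n) F → ℂ} (hf : f ∈ querySpan F n n k) (a : F) :
    (Fintype.card F : ℂ) * ∑ M, (if M.trace = a then f M else 0) = ∑ M, f M := by
  calc (Fintype.card F : ℂ) * ∑ M, (if M.trace = a then f M else 0)
      = ∑ b : F, ∑ M : Matrix (Fin n) (Fin n) F, (if M.trace = b then f M else 0) := by
        rw [Finset.sum_congr rfl fun b _ => sum_trace_eq_of_mem_querySpan hk hf b a]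
        simp
    _ = ∑ M, f M := by
        rw [Finset.sum_comm]
        simp

end QuerySpan

section Oracle

variable {F : Type*} [Field F] [Fintype F] [DecidableEq F] {m n : ℕ}
  {W : Type*} [Fintype W] [DecidableEq W]

/-- Here `ψ` is evaluated only at labels free of `M`; the oracle's dependence on `M` sits in
indicators of degree 1, as the degree count needs. -/
theorem mvOracle_mulVec_eq_sum (M : Matrix (Fin m) (Fin n) F) (ψ : MVBasis F m n W → ℂ)
    (i : MVBasis F m n W) :
    (mvOracle W M *ᵥ ψ) i =
      ∑ y : Fin m → F, (if M *ᵥ i.1 = i.2.1 - y then 1 else 0) * ψ (i.1, y, i.2.2) := by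
  obtain ⟨x, y, w⟩ := i
  change ∑ j, mvOracle W M (x, y, w) j * ψ j = _
  simp only [mvOracle, Matrix.of_apply, Prod.mk.injEq, Fintype.sum_prod_type]
  rw [Finset.sum_eq_single x]
  · refine Finset.sum_congr rfl fun y' _ => ?_
    rw [Finset.sum_eq_single w]
    · have : y = y' + M *ᵥ x ↔ M *ᵥ x = y - y' := by
        rw [eq_sub_iff_add_eq', eq_comm]
      simp [this]
    · intro w' _ hw
      simp [hw.symm]
    · simp
  · intro x' _ hx
    simp [hx.symm]
  · simp

theorem mvOracle_mulVec (M : Matrix (Fin m) (Fin n) F) (ψ : MVBasis F m n W → ℂ)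
    (i : MVBasis F m n W) :
    (mvOracle W M *ᵥ ψ) i = ψ (i.1, i.2.1 - M *ᵥ i.1, i.2.2) := by
  rw [mvOracle_mulVec_eq_sum, Finset.sum_eq_single (i.2.1 - M *ᵥ i.1)]
  · simp
  · intro y _ hy
    rw [if_neg, zero_mul]
    rintro h
    exact hy (by rw [h, sub_sub_cancel])
  · simp

/-- The permutation of the basis labels that undoes a query. -/
def mvShift (W : Type*) (M : Matrix (Fin m) (Fin n) F) : Equiv.Perm (MVBasis F m n W) where
  toFun i := (i.1, i.2.1 - M *ᵥ i.1, i.2.2)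
  invFun i := (i.1, i.2.1 + M *ᵥ i.1, i.2.2)
  left_inv i := by simp
  right_inv i := by simp

theorem star_mvOracle_mulVec_dotProduct (M : Matrix (Fin m) (Fin n) F)
    (ψ : MVBasis F m n W → ℂ) :
    star (mvOracle W M *ᵥ ψ) ⬝ᵥ (mvOracle W M *ᵥ ψ) = star ψ ⬝ᵥ ψ := by
  refine Fintype.sum_equiv (mvShift W M) _ _ fun i => ?_
  rw [Pi.star_apply, mvOracle_mulVec]
  rfl

theorem star_unitary_mulVec_dotProduct {ι : Type*} [Fintype ι] [DecidableEq ι]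
    (U : Matrix.unitaryGroup ι ℂ) (ψ : ι → ℂ) :
    star (U.1 *ᵥ ψ) ⬝ᵥ (U.1 *ᵥ ψ) = star ψ ⬝ᵥ ψ := by
  rw [Matrix.star_mulVec, Matrix.dotProduct_mulVec, Matrix.vecMul_vecMul,
    ← Matrix.star_eq_conjTranspose, Matrix.UnitaryGroup.star_mul_self, Matrix.vecMul_one]

end Oracle

namespace MVQueryAlgorithm

variable {F : Type*} [Field F] [Fintype F] [DecidableEq F] {m n : ℕ}
  {W : Type*} [Fintype W] [DecidableEq W] {t : ℕ} {A : Type*} [Fintype A]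
  (𝒜 : MVQueryAlgorithm F m n W t A)

theorem state_zero (M : Matrix (Fin m) (Fin n) F) :
    𝒜.state M 0 = (𝒜.gate 0).1 *ᵥ 𝒜.init := rfl

theorem state_succ (M : Matrix (Fin m) (Fin n) F) (k : Fin t) :
    𝒜.state M k.succ = (𝒜.gate k.succ).1 *ᵥ (mvOracle W M *ᵥ 𝒜.state M k.castSucc) := rfl

theorem star_state_dotProduct (M : Matrix (Fin m) (Fin n) F) (k : Fin (t + 1)) :
    star (𝒜.state M k) ⬝ᵥ 𝒜.state M k = 1 := by
  induction k using Fin.induction with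
  | zero =>
    rw [state_zero, star_unitary_mulVec_dotProduct]
    have h := congrArg (Complex.ofReal) 𝒜.init_norm
    push_cast at h
    rw [← h]
    refine Finset.sum_congr rfl fun i _ => ?_
    rw [Pi.star_apply, ← Complex.conj_mul']
    rfl
  | succ k ih =>
    rw [state_succ, star_unitary_mulVec_dotProduct, star_mvOracle_mulVec_dotProduct, ih]

/-- The polynomial method: amplitudes after `k` queries depend on `M` through combinations of
functions of at most `k` matrix-vector products. -/
theorem state_mem_querySpan (k : Fin (t + 1)) (i : MVBasis F m n W) :
    (fun M => 𝒜.state M k i) ∈ querySpan F m n k := by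
  induction k using Fin.induction generalizing i with
  | zero => exact const_mem_querySpan _ _
  | succ k ih =>
    simp only [state_succ]
    refine mulVec_mem_querySpan _ (fun j => ?_) i
    simp only [mvOracle_mulVec_eq_sum]
    refine sum_mem_querySpan _ fun y _ => ?_
    rw [Fin.val_succ, add_comm]
    exact mul_mem_querySpan (indicator_mem_querySpan _ _) (ih _)

/-- The output amplitude `⟨ψ| E_a |ψ⟩`, whose real part is `outputProb`. -/
def outputExp (M : Matrix (Fin m) (Fin n) F) (a : A) : ℂ :=
  star (𝒜.state M (Fin.last t)) ⬝ᵥ (𝒜.meas a *ᵥ 𝒜.state M (Fin.last t))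

/-- The bra and the ket each contribute degree `t`, which is the source of the bound `n / 2`. -/
theorem outputExp_mem_querySpan (a : A) :
    (fun M => 𝒜.outputExp M a) ∈ querySpan F m n (t + t) :=
  sum_mem_querySpan _ fun i _ => mul_mem_querySpan
    (star_mem_querySpan (𝒜.state_mem_querySpan (Fin.last t) i))
    (mulVec_mem_querySpan _ (𝒜.state_mem_querySpan (Fin.last t)) i)

theorem sum_outputExp (M : Matrix (Fin m) (Fin n) F) : ∑ a, 𝒜.outputExp M a = 1 := by
  simp only [outputExp]
  rw [← dotProduct_sum, ← Matrix.sum_mulVec, 𝒜.meas_sum, Matrix.one_mulVec,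
    star_state_dotProduct]

/-- With fewer than `n / 2` queries the trace is guessed with probability exactly `1 / q`. -/
theorem avgSuccess_trace_of_lt (ℬ : MVQueryAlgorithm F n n W t F) (h : t + t < n) :
    ℬ.avgSuccess Matrix.trace = 1 / (Fintype.card F : ℝ) := by
  have key : (Fintype.card F : ℂ) * ∑ M : Matrix (Fin n) (Fin n) F, ℬ.outputExp M M.trace =
      Fintype.card (Matrix (Fin n) (Fin n) F) := by
    -- Split by the value `a` of the trace; each class carries a `1/q` share of the total for
    -- outcome `a`, and the outcomes sum to 1 for every `M`.
    calc _ = ∑ a : F, (Fintype.card F : ℂ) *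
          ∑ M : Matrix (Fin n) (Fin n) F, (if M.trace = a then ℬ.outputExp M a else 0) := by
            rw [← Finset.mul_sum, Finset.sum_comm]
            simp
      _ = ∑ a : F, ∑ M, ℬ.outputExp M a := Finset.sum_congr rfl fun a _ =>
            card_mul_sum_trace_of_mem_querySpan h (ℬ.outputExp_mem_querySpan a) a
      _ = _ := by
            rw [Finset.sum_comm]
            simp [sum_outputExp]
  have key' : (Fintype.card F : ℝ) * ∑ M : Matrix (Fin n) (Fin n) F, ℬ.outputProb M M.trace =
      Fintype.card (Matrix (Fin n) (Fin n) F) := by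
    have := congrArg Complex.re key
    rwa [← Complex.ofReal_natCast, Complex.re_ofReal_mul, Complex.re_sum,
      Complex.natCast_re] at this
  have hF : (Fintype.card F : ℝ) ≠ 0 := Nat.cast_ne_zero.2 Fintype.card_ne_zero
  have hM : (Fintype.card (Matrix (Fin n) (Fin n) F) : ℝ) ≠ 0 :=
    Nat.cast_ne_zero.2 Fintype.card_ne_zero
  rw [avgSuccess, div_eq_div_iff hM hF, one_mul, mul_comm, key']

end MVQueryAlgorithm

theorem mainTheorem3 {F : Type*} [Field F] [Fintype F] [DecidableEq F] (n t : ℕ)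
    {W : Type*} [Fintype W] [DecidableEq W] (𝒜 : MVQueryAlgorithm F n n W t F) :
    (1 / (Fintype.card F : ℝ) < 𝒜.avgSuccess Matrix.trace → (n : ℝ) / 2 ≤ (t : ℝ)) ∧
    ((∀ M : Matrix (Fin n) (Fin n) F, 1 / (Fintype.card F : ℝ) < 𝒜.outputProb M M.trace) →
      (n : ℝ) / 2 ≤ (t : ℝ)) := by
  have main : 1 / (Fintype.card F : ℝ) < 𝒜.avgSuccess Matrix.trace → (n : ℝ) / 2 ≤ (t : ℝ) := by
    intro h
    by_contra! ht
    have hlt : t + t < n := by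
      have : (t : ℝ) + t < n := by linarith
      exact_mod_cast this
    exact h.ne' (𝒜.avgSuccess_trace_of_lt hlt)
  refine ⟨main, fun h => main ?_⟩
  have hM : (0 : ℝ) < Fintype.card (Matrix (Fin n) (Fin n) F) :=
    Nat.cast_pos.2 Fintype.card_pos
  rw [MVQueryAlgorithm.avgSuccess, lt_div_iff₀ hM]
  calc _ = ∑ _M : Matrix (Fin n) (Fin n) F, 1 / (Fintype.card F : ℝ) := by
        rw [Finset.sum_const, nsmul_eq_mul, mul_comm, Finset.card_univ]
    _ < _ := Finset.sum_lt_sum_of_nonempty Finset.univ_nonempty fun M _ => h M
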